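/- A garden-hose game of size $s\in\mathbb N$ on inputs from $\{0,1\}^n\times\{0,1\}^n$ consists of vertex sets $A_\circ=\{0,1^A,\dots,s^A\}$ and $B=\{1^B,\dots,s^B\}$, the edges $\{i^A,i^B\}$ for $1\le i\le s$ (the pipes), and two functions that assign to each $x\in\{0,1\}^n$ a set $E_{A_\circ}(x)$ of edges on $A_\circ$ and to each $y\in\{0,1\}^n$ a set $E_B(y)$ of edges on $B$, each forming a graph without loops of maximum degree at most $1$. Let $G(x,y)$ be the graph on $A_\circ\cup B$ with all these edges. The game computes $f:\{0,1\}^n\times\{0,1\}^n\to\{0,1\}$ if, for all $x,y$, the (unique) maximal path in $G(x,y)$ that starts at $0$ ends in $A_\circ$ when $f(x,y)=0$ and in $B$ when $f(x,y)=1$. The garden-hose complexity $\mathrm{gh}(f)$ is the least size of a game that computes $f$. A family $g=(g_m)_{m\in\mathbb N}$ of functions $g_m:\{0,1\}^m\times\{0,1\}^m\to\{0,1\}$ is log-space computable if there are a constant $c$ and a single deterministic Turing machine, with a read-only input tape and finitely many work tapes, that for all $m$ and all $x,y\in\{0,1\}^m$ halts with output $g_m(x,y)$ on the input $xy$ of length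 $2m$, and, if $m\ge 1$, visits at most $c\log_2(2m)$ locations of its work tapes. Let $f=(f_n)_{n\in\mathbb N}$ be a family of functions $f_n:\{0,1\}^n\times\{0,1\}^n\to\{0,1\}$. If $\mathrm{gh}(f_n)$ is bounded by a polynomial in $n$, then $f$ is log-space computable up to local pre-processing: there are a function $m:\mathbb N\to\mathbb N$ bounded by a polynomial, a log-space computable family $g=(g_k)_{k\in\mathbb N}$, and for each $n$ functions $\alpha_n,\beta_n:\{0,1\}^n\to\{0,1\}^{m(n)}$ such that $$f_n(x,y)=g_{m(n)}(\alpha_n(x),\beta_n(y))\qquad\text{for all } n \text{ and all } x,y\in\{0,1\}^n.$$ -/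

import Mathlib

/-- The set `{0,1}^n`. -/
abbrev Bits (n : ℕ) : Type := Fin n → Bool

/-! ### The garden-hose game -/

/-- A garden-hose game with `s` pipes on inputs from `{0,1}^n × {0,1}^n`. Alice's vertex set `A_∘`
is `Option (Fin s)`, with `none` the water tap; Bob's vertex set `B` is `Fin s`.
Each player picks a graph of maximum degree at most one, depending on the own input only. -/
structure GardenHoseGame (n s : ℕ) where
  /-- Alice's connections among the tap and the pipe ends on her side. -/
  alice : Bits n → SimpleGraph (Option (Fin s))
  /-- Bob's connections among the pipe ends on his side. -/
  bob : Bits n → SimpleGraph (Fin s)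
  alice_unique : ∀ x u v w, (alice x).Adj u v → (alice x).Adj u w → v = w
  bob_unique : ∀ y u v w, (bob y).Adj u v → (bob y).Adj u w → v = w

namespace GardenHoseGame

/-- The pipes: the `i`-th vertex on Alice's side is joined to the `i`-th one on Bob's side. -/
def pipes (s : ℕ) : SimpleGraph (Option (Fin s) ⊕ Fin s) :=
  SimpleGraph.fromEdgeSet {e | ∃ i : Fin s, e = s(Sum.inl (some i), Sum.inr i)}

/-- The graph `G(x,y)` on `A_∘ ∪ B`: the pipes with the connections of Alice and Bob. -/
def graph {n s : ℕ} (G : GardenHoseGame n s) (x y : Bits n) :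
    SimpleGraph (Option (Fin s) ⊕ Fin s) :=
  pipes s ⊔ (G.alice x).map Function.Embedding.inl ⊔ (G.bob y).map Function.Embedding.inr

/-- The water tap. -/
abbrev tap (s : ℕ) : Option (Fin s) ⊕ Fin s := Sum.inl none

/-- `v` is the endpoint of a maximal path of `G(x,y)` that starts at the tap: no further vertex
can be appended to the path. -/
def IsEndpoint {n s : ℕ} (G : GardenHoseGame n s) (x y : Bits n)
    (v : Option (Fin s) ⊕ Fin s) : Prop :=
  ∃ p : (G.graph x y).Walk (tap s) v, p.IsPath ∧ ∀ w, (G.graph x y).Adj v w → w ∈ p.support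

/-- The game computes `f`: the water comes out on Alice's side if `f(x,y) = 0` and on Bob's side
if `f(x,y) = 1`. -/
def Computes {n s : ℕ} (G : GardenHoseGame n s) (f : Bits n → Bits n → Bool) : Prop :=
  ∀ x y, ∃ v, G.IsEndpoint x y v ∧
    (f x y = false → v.isLeft = true) ∧ (f x y = true → v.isRight = true)

end GardenHoseGame

/-- The garden-hose complexity: the least number of pipes of a game that computes `f`
(the value would be `⊤` if there were no such game). -/
noncomputable def gardenHoseComplexity {n : ℕ} (f : Bits n → Bits n → Bool) : ℕ∞ :=
  sInf {t : ℕ∞ | ∃ (s : ℕ) (G : GardenHoseGame n s), G.Computes f ∧ t = (s : ℕ∞)}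

/-! ### Turing machines with a read-only input tape and work tapes -/

/-- What the input head can read: a bit of the input or one of the two end markers. -/
inductive InputSymbol : Type
  | leftEnd
  | rightEnd
  | bit (b : Bool)

/-- Head movements. -/
inductive HeadMove : Type
  | left
  | stay
  | right

/-- A deterministic Turing machine with a read-only two-way input tape and `numTapes` work tapes,
infinite in both directions, that answers by accepting or rejecting. -/
structure OfflineTM where
  /-- The number of work tapes. -/
  numTapes : ℕ
  /-- The states. -/
  State : Type
  /-- The work alphabet. -/
  Sym : Type
  [finState : Finite State]
  [decState : DecidableEq State]
  [finSym : Finite Sym]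
  blank : Sym
  start : State
  accept : State
  reject : State
  accept_ne_reject : accept ≠ reject
  /-- From the state, the scanned input symbol and the scanned work symbols, the new state, the
  movement of the input head, and for each work tape the symbol written and the movement. -/
  trans : State → InputSymbol → (Fin numTapes → Sym) →
    State × HeadMove × (Fin numTapes → Sym × HeadMove)

namespace OfflineTM

attribute [instance] finState decState finSym

/-- The input tape holds the left end marker at position `0`, the input `w` at the positions
`1, …, w.length`, and the right end marker at position `w.length + 1`. -/
def readInput (w : List Bool) : ℕ → InputSymbol
  | 0 => InputSymbol.leftEnd
  | i + 1 =>
    match w[i]? with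
    | some b => InputSymbol.bit b
    | none => InputSymbol.rightEnd

/-- Movement of the input head on an input of length `N`: it never leaves the end markers. -/
def moveInput (N pos : ℕ) : HeadMove → ℕ
  | HeadMove.left => pos - 1
  | HeadMove.stay => pos
  | HeadMove.right => min (pos + 1) (N + 1)

/-- Movement of a work head. -/
def moveWork (pos : ℤ) : HeadMove → ℤ
  | HeadMove.left => pos - 1
  | HeadMove.stay => pos
  | HeadMove.right => pos + 1

/-- A configuration, without the content of the input tape. -/
structure Cfg (M : OfflineTM) where
  state : M.State
  inputPos : ℕ
  workPos : Fin M.numTapes → ℤ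
  work : Fin M.numTapes → ℤ → M.Sym

/-- The initial configuration: blank work tapes, input head on the first input position. -/
def init (M : OfflineTM) : M.Cfg where
  state := M.start
  inputPos := 1
  workPos := fun _ => 0
  work := fun _ _ => M.blank

/-- One step on input `w`; `none` if the machine has halted. -/
def step (M : OfflineTM) (w : List Bool) (c : M.Cfg) : Option M.Cfg :=
  if c.state = M.accept ∨ c.state = M.reject then none
  else
    let r := M.trans c.state (readInput w c.inputPos) (fun t => c.work t (c.workPos t))
    some
      { state := r.1
        inputPos := moveInput w.length c.inputPos r.2.1
        workPos := fun t => moveWork (c.workPos t) (r.2.2 t).2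
        work := fun t => Function.update (c.work t) (c.workPos t) (r.2.2 t).1 }

/-- On input `w` the machine halts with output `b` (accepting means `1`, rejecting means `0`). -/
def Outputs (M : OfflineTM) (w : List Bool) (b : Bool) : Prop :=
  ∃ c, StateTransition.Reaches (M.step w) M.init c ∧ c.state = if b then M.accept else M.reject

/-- The work tape locations (tape, cell) visited during the computation on input `w`. -/
def visited (M : OfflineTM) (w : List Bool) : Set (Fin M.numTapes × ℤ) :=
  {q | ∃ c, StateTransition.Reaches (M.step w) M.init c ∧ c.workPos q.1 = q.2}

end OfflineTM

/-- The family `g_m : {0,1}^m × {0,1}^m → {0,1}` is log-space computable: one machine outputs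
`g_m(x,y)` on every input `xy`, visiting at most `c log N` work tape locations on inputs of
length `N = 2m`. (The bound is asked for `N ≥ 2` because `log N` is undefined or zero below; the
machine halts on the finitely many shorter inputs, so the number of locations is bounded there.) -/
def LogSpaceComputable (g : ∀ m : ℕ, Bits m → Bits m → Bool) : Prop :=
  ∃ (M : OfflineTM) (c : ℕ), ∀ (m : ℕ) (x y : Bits m),
    M.Outputs (List.ofFn x ++ List.ofFn y) (g m x y) ∧
      (2 ≤ 2 * m →
        (M.visited (List.ofFn x ++ List.ofFn y)).encard ≤ ((c * Nat.log 2 (2 * m) : ℕ) : ℕ∞))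

/-! ### Local pre-processing -/

/-- `f` is obtained from `g` by local pre-processing. -/
def ObtainedByLocalPreprocessing {n m : ℕ} (f : Bits n → Bits n → Bool)
    (g : Bits m → Bits m → Bool) : Prop :=
  ∃ α β : Bits n → Bits m, ∀ x y, f x y = g (α x) (β y)

/-- The family `f` is log-space computable up to local pre-processing: each `f_n` is obtained by
local pre-processing from the member `g_{m(n)}` of a log-space computable family `g`, where `m(n)`
is polynomially bounded in `n`. -/
def LogSpaceUpToLocalPreprocessing (f : ∀ n : ℕ, Bits n → Bits n → Bool) : Prop :=
  ∃ (m : ℕ → ℕ) (g : ∀ k : ℕ, Bits k → Bits k → Bool),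
    (∃ q : Polynomial ℕ, ∀ n, m n ≤ q.eval n) ∧
      LogSpaceComputable g ∧
      ∀ n, ObtainedByLocalPreprocessing (f n) (g (m n))

/-! The water flows alternately along a connection made by a player and along a pipe, and every pipe
changes sides. Once both matchings are written down, finding the exit is pointer chasing, for which
logarithmic memory suffices. The matchings are the outcome of the local pre-processing, and one
fixed machine follows the pointers.

The pointers are relative and in unary. A vertex becomes a block `0 1^d`, where `d` counts the
delimiters to pass, after the block has been read, to reach the far end of the pipe to which the
vertex is connected: to the right for Alice, to the left for Bob. A vertex at which the water stops
has `d = 0`, and the output is then whose turn it is. The input head itself marks the current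
vertex, so only the distance has to be counted. A second counter holds fuel, as much as the input is
long; it enforces halting on inputs that are not codes.

`doubleSteps_of_isPath` turns a maximal path into alternating steps, `halts_of_doubleSteps` runs a
two-counter program along them, and `outputs_and_visited` simulates counter programs with binary
counters on the work tapes; `inv_step` bounds the counters linearly in the input length. Halting is
proved backwards, from a configuration that halts to its predecessor. -/

/-! ### Halting computations that satisfy a predicate throughout -/

namespace OfflineTM

/-- From the configuration `c`, the machine halts with output `b`, and all configurations on the
way satisfy `P`. -/
inductive HaltsWithin (M : OfflineTM) (w : List Bool) (P : M.Cfg → Prop) (b : Bool) :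
    M.Cfg → Prop
  | halt {c : M.Cfg} (hP : P c) (hc : c.state = if b then M.accept else M.reject) :
      HaltsWithin M w P b c
  | step {c c' : M.Cfg} (hP : P c) (hs : M.step w c = some c') (h : HaltsWithin M w P b c') :
      HaltsWithin M w P b c

theorem step_eq_some {M : OfflineTM} {w : List Bool} {c : M.Cfg} {st : M.State} {d : HeadMove}
    {act : Fin M.numTapes → M.Sym × HeadMove}
    (h : ¬ (c.state = M.accept ∨ c.state = M.reject))
    (ht : M.trans c.state (readInput w c.inputPos) (fun t => c.work t (c.workPos t)) =
      (st, d, act)) :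
    M.step w c = some
      { state := st
        inputPos := moveInput w.length c.inputPos d
        workPos := fun t => moveWork (c.workPos t) (act t).2
        work := fun t => Function.update (c.work t) (c.workPos t) (act t).1 } := by
  rw [OfflineTM.step, if_neg h]
  simp only [ht]

theorem HaltsWithin.exists_reaches {M : OfflineTM} {w : List Bool} {P : M.Cfg → Prop} {b : Bool}
    {c : M.Cfg} (h : M.HaltsWithin w P b c) :
    ∃ c', StateTransition.Reaches (M.step w) c c' ∧
      c'.state = if b then M.accept else M.reject := by
  induction h with
  | halt _ hc => exact ⟨_, Relation.ReflTransGen.refl, hc⟩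
  | step _ hs _ ih =>
    obtain ⟨c', h, hc'⟩ := ih
    exact ⟨c', Relation.ReflTransGen.head hs h, hc'⟩

/-- The machine is deterministic, so every configuration reached from `c` lies on the halting run.
This is what bounds `visited`. -/
theorem HaltsWithin.of_reaches {M : OfflineTM} {w : List Bool} {P : M.Cfg → Prop} {b : Bool}
    {c d : M.Cfg} (h : M.HaltsWithin w P b c) (hd : StateTransition.Reaches (M.step w) c d) :
    P d := by
  induction h with
  | @halt c hP hc =>
    rcases Relation.ReflTransGen.cases_head hd with rfl | ⟨c', hs, _⟩
    · exact hP
    · have : M.step w c = none := by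
        rw [OfflineTM.step, if_pos]
        cases b <;> simp_all
      simp [this] at hs
  | step hP hs _ ih =>
    rcases Relation.ReflTransGen.cases_head hd with rfl | ⟨c', hs', hd'⟩
    · exact hP
    · rw [hs, Option.mem_def, Option.some.injEq] at hs'
      exact ih (hs' ▸ hd')

end OfflineTM

/-! ### Counter programs -/

/-- An instruction for a program with `k` counters and a two-way input head. Every instruction but
the last also moves the input head. -/
inductive CounterInstr (k : ℕ) (Q : Type) : Type
  /-- Increment counter `i`. -/
  | inc (i : Fin k) (d : HeadMove) (q : Q)
  /-- Decrement counter `i` and go to `q`, or go to `q₀` if the counter is zero. -/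
  | dec (i : Fin k) (d : HeadMove) (q q₀ : Q)
  /-- Leave the counters alone. -/
  | move (d : HeadMove) (q : Q)
  /-- Halt with output `b`. -/
  | halt (b : Bool)

/-- The configurations of a program with `k` counters. -/
structure CounterCfg (k : ℕ) (Q : Type) where
  state : Q
  pos : ℕ
  cnt : Fin k → ℕ

/-- A program: the instruction to execute in each state on each scanned symbol. -/
abbrev CounterProgram (k : ℕ) (Q : Type) : Type := Q → InputSymbol → CounterInstr k Q

namespace CounterProgram

variable {k : ℕ} {Q : Type}

/-- One step of a counter program; the output if the program halts. -/
def step (C : CounterProgram k Q) (w : List Bool) (c : CounterCfg k Q) : CounterCfg k Q ⊕ Bool :=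
  match C c.state (OfflineTM.readInput w c.pos) with
  | .inc i d q =>
    .inl ⟨q, OfflineTM.moveInput w.length c.pos d, Function.update c.cnt i (c.cnt i + 1)⟩
  | .dec i d q q₀ =>
    .inl ⟨if c.cnt i = 0 then q₀ else q, OfflineTM.moveInput w.length c.pos d,
      Function.update c.cnt i (c.cnt i - 1)⟩
  | .move d q => .inl ⟨q, OfflineTM.moveInput w.length c.pos d, c.cnt⟩
  | .halt b => .inr b

/-- From the given configuration the program halts with output `b`. -/
inductive Halts (C : CounterProgram k Q) (w : List Bool) (b : Bool) : CounterCfg k Q → Prop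
  | halt {c : CounterCfg k Q} (h : C.step w c = .inr b) : Halts C w b c
  | step {c c' : CounterCfg k Q} (hs : C.step w c = .inl c') (h : Halts C w b c') : Halts C w b c

end CounterProgram

/-! ### Binary counters as lists of digits, least significant digit first -/

namespace BinaryCounter

/-- The number with the given binary digits. -/
def value : List Bool → ℕ
  | [] => 0
  | c :: l => c.toNat + 2 * value l

/-- Flip the digits `b` up to and including the first digit `!b`. For `b = 1` this is the
successor, for `b = 0` the predecessor, with `none` for underflow. -/
def carry (b : Bool) : List Bool → Option (List Bool)
  | [] => if b then some [true] else none
  | c :: l => if c = b then (carry b l).map ((!b) :: ·) else some (b :: l)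

theorem carry_true_ne_none (l : List Bool) : carry true l ≠ none := by
  induction l with
  | nil => simp [carry]
  | cons c l ih => cases c <;> simp [carry, ih]

theorem value_carry_true {l l' : List Bool} (h : carry true l = some l') :
    value l' = value l + 1 := by
  induction l generalizing l' with
  | nil => simp [carry] at h; subst h; simp [value]
  | cons c l ih =>
    cases c
    · simp [carry] at h; subst h; simp [value]; omega
    · simp [carry] at h
      obtain ⟨m, hm, rfl⟩ := h
      simp [value, ih hm]; omega

theorem value_carry_false {l l' : List Bool} (h : carry false l = some l') :
    value l = value l' + 1 := by
  induction l generalizing l' with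
  | nil => simp [carry] at h
  | cons c l ih =>
    cases c
    · simp [carry] at h
      obtain ⟨m, hm, rfl⟩ := h
      simp [value, ih hm]; omega
    · simp [carry] at h; subst h; simp [value]; omega

theorem value_eq_zero_of_carry_false {l : List Bool} (h : carry false l = none) :
    value l = 0 := by
  induction l with
  | nil => rfl
  | cons c l ih =>
    cases c
    · simp [carry] at h
      simp [value, ih h]
    · simp [carry] at h

theorem length_carry_false {l l' : List Bool} (h : carry false l = some l') :
    l'.length = l.length := by
  induction l generalizing l' with
  | nil => simp [carry] at h
  | cons c l ih =>
    cases c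
    · simp [carry] at h
      obtain ⟨m, hm, rfl⟩ := h
      simp [ih hm]
    · simp [carry] at h; subst h; simp

/-- A digit is appended only if all digits are `1`; the result is then a power of two. -/
theorem length_carry_true {l l' : List Bool} (h : carry true l = some l') :
    l'.length = l.length ∨ l'.length = l.length + 1 ∧ value l' = 2 ^ l.length := by
  induction l generalizing l' with
  | nil => simp [carry] at h; subst h; simp [value]
  | cons c l ih =>
    cases c
    · simp [carry] at h; subst h; simp
    · simp [carry] at h
      obtain ⟨m, hm, rfl⟩ := h
      rcases ih hm with h | ⟨h, h'⟩
      · simp [h]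
      · right; simp [h, value, h', pow_succ]; omega

/-- Growth happens only at powers of two, so a bound on the value bounds the length, even though a
decrement leaves leading zeros in place. -/
theorem length_carry_true_le {l l' : List Bool} {K : ℕ} (h : carry true l = some l')
    (hl : l.length ≤ K) (hv : value l' < 2 ^ K) : l'.length ≤ K := by
  rcases length_carry_true h with h | ⟨h, h'⟩
  · omega
  · rw [h', Nat.pow_lt_pow_iff_right (by norm_num)] at hv
    omega

/-- The work tape that holds the given digits from cell `0` on. -/
def tape (l : List Bool) (z : ℤ) : Option Bool :=
  if z < 0 then none else l[z.toNat]?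

theorem tape_append_length (l m : List Bool) : tape (l ++ m) l.length = m[0]? := by
  simp [tape, not_lt.2 (Int.natCast_nonneg l.length), List.getElem?_append_right]

theorem tape_nil : tape [] = fun _ => none := by
  funext z; simp [tape]

theorem update_tape_append (l m : List Bool) (c : Bool) :
    Function.update (tape (l ++ m)) l.length (some c) = tape (l ++ c :: m.tail) := by
  funext z
  by_cases hz : z < 0
  · rw [Function.update_of_ne (by omega)]; simp [tape, hz]
  · lift z to ℕ using by omega
    by_cases h : z = l.length
    · subst h; simp [tape]
    · rw [Function.update_of_ne (by omega)]
      simp only [tape, hz, if_false, Int.toNat_natCast, List.getElem?_append]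
      split_ifs with h'
      · rfl
      · obtain ⟨j, hj⟩ : ∃ j, z - l.length = j + 1 := ⟨z - l.length - 1, by omega⟩
        simp [hj]

theorem update_tape_concat_none (l : List Bool) (c : Bool) :
    Function.update (tape (l ++ [c])) l.length none = tape l := by
  funext z
  by_cases hz : z < 0
  · rw [Function.update_of_ne (by omega)]; simp [tape, hz]
  · lift z to ℕ using by omega
    by_cases h : z = l.length
    · subst h; simp [tape]
    · rw [Function.update_of_ne (by omega)]
      simp only [tape, hz, if_false, Int.toNat_natCast, List.getElem?_append]
      split_ifs with h'
      · rfl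
      · obtain ⟨j, hj⟩ : ∃ j, z - l.length = j + 1 := ⟨z - l.length - 1, by omega⟩
        rw [hj, List.getElem?_eq_none (by simp), List.getElem?_eq_none (by omega)]

theorem tape_eq_none_of_neg {l : List Bool} {z : ℤ} (hz : z < 0) : tape l z = none := by
  simp [tape, hz]

end BinaryCounter

/-! ### Simulation of counter programs by Turing machines -/

namespace CounterProgram

open BinaryCounter OfflineTM

/-- The states of the simulating machine. -/
inductive SimState (k : ℕ) (Q : Type) : Type
  /-- About to execute the instruction for `q`. -/
  | main (q : Q)
  /-- Propagating a carry on tape `i`; afterwards go to `q`, or to `q₀` after an underflow. -/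
  | sweep (b : Bool) (i : Fin k) (q q₀ : Q)
  /-- Returning to cell `0` of tape `i`. -/
  | back (i : Fin k) (q : Q)
  /-- Erasing tape `i` while returning to cell `0`. -/
  | erase (i : Fin k) (q : Q)
  /-- Halted with output `b`. -/
  | halted (b : Bool)

variable {k : ℕ} {Q : Type}

instance [Finite Q] : Finite (SimState k Q) := by
  let g : SimState k Q →
      Q ⊕ (Bool × Fin k × Q × Q) ⊕ (Fin k × Q) ⊕ (Fin k × Q) ⊕ Bool := fun
    | .main q => .inl q
    | .sweep b i q q₀ => .inr (.inl (b, i, q, q₀))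
    | .back i q => .inr (.inr (.inl (i, q)))
    | .erase i q => .inr (.inr (.inr (.inl (i, q))))
    | .halted b => .inr (.inr (.inr (.inr b)))
  refine Finite.of_injective g ?_
  rintro (_ | _ | _ | _ | _) (_ | _ | _ | _ | _) h <;> simp_all [g]

/-- Keep the scanned symbols and the work heads, except on tape `i`. -/
def actOn (σ : Fin k → Option Bool) (i : Fin k) (a : Option Bool) (d : HeadMove) :
    Fin k → Option Bool × HeadMove :=
  Function.update (fun t => (σ t, HeadMove.stay)) i (a, d)

/-- The transition function of the simulating machine. -/
def simTrans (C : CounterProgram k Q) :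
    SimState k Q → InputSymbol → (Fin k → Option Bool) →
      SimState k Q × HeadMove × (Fin k → Option Bool × HeadMove)
  | .main q, a, σ =>
    match C q a with
    | .inc i d q' => (.sweep true i q' q', d, fun t => (σ t, .stay))
    | .dec i d q' q₀ => (.sweep false i q' q₀, d, fun t => (σ t, .stay))
    | .move d q' => (.main q', d, fun t => (σ t, .stay))
    | .halt b => (.halted b, .stay, fun t => (σ t, .stay))
  | .sweep b i q q₀, _, σ =>
    match σ i with
    | some c =>
      if c = b then (.sweep b i q q₀, .stay, actOn σ i (some !b) .right)
      else (.back i q, .stay, actOn σ i (some b) .left)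
    | none =>
      if b then (.back i q, .stay, actOn σ i (some true) .left)
      else (.erase i q₀, .stay, actOn σ i none .left)
  | .back i q, _, σ =>
    match σ i with
    | some c => (.back i q, .stay, actOn σ i (some c) .left)
    | none => (.main q, .stay, actOn σ i none .right)
  | .erase i q, _, σ =>
    match σ i with
    | some _ => (.erase i q, .stay, actOn σ i none .left)
    | none => (.main q, .stay, actOn σ i none .right)
  | .halted b, _, σ => (.halted b, .stay, fun t => (σ t, .stay))

open Classical in
/-- The Turing machine that simulates a counter program, with one work tape for each counter. -/
noncomputable abbrev toTM [Finite Q] (C : CounterProgram k Q) (q : Q) : OfflineTM where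
  numTapes := k
  State := SimState k Q
  Sym := Option Bool
  blank := none
  start := .main q
  accept := .halted true
  reject := .halted false
  accept_ne_reject := by simp
  trans := C.simTrans

variable [Finite Q]

/-- The configuration of the simulating machine with the given digits on the work tapes, the head
of tape `i` at `z` and the other work heads at `0`. -/
noncomputable def simCfg (C : CounterProgram k Q) (q₁ : Q) (st : SimState k Q) (pos : ℕ)
    (L : Fin k → List Bool) (i : Fin k) (z : ℤ) : (C.toTM q₁).Cfg where
  state := st
  inputPos := pos
  workPos := Function.update (fun _ => 0) i z
  work := fun t => tape (L t)

/-- The configuration of the simulating machine between two instructions. -/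
noncomputable def mainCfg (C : CounterProgram k Q) (q₁ : Q) (st : SimState k Q) (pos : ℕ)
    (L : Fin k → List Bool) : (C.toTM q₁).Cfg where
  state := st
  inputPos := pos
  workPos := fun _ => 0
  work := fun t => tape (L t)

/-- All work heads are between the cells `-1` and `K`. -/
def HeadsWithin (C : CounterProgram k Q) (q₁ : Q) (K : ℕ) (c : (C.toTM q₁).Cfg) : Prop :=
  ∀ t, c.workPos t ∈ Set.Icc (-1 : ℤ) K

theorem simCfg_zero (C : CounterProgram k Q) (q₁ : Q) (st : SimState k Q) (pos : ℕ)
    (L : Fin k → List Bool) (i : Fin k) : C.simCfg q₁ st pos L i 0 = C.mainCfg q₁ st pos L := by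
  have : Function.update (fun _ : Fin k => (0 : ℤ)) i 0 = fun _ => 0 :=
    Function.update_eq_self i _
  simp only [simCfg, mainCfg, this]

theorem headsWithin_simCfg {C : CounterProgram k Q} {q₁ : Q} {st : SimState k Q} {pos : ℕ}
    {L : Fin k → List Bool} {i : Fin k} {z : ℤ} {K : ℕ} (h : z ∈ Set.Icc (-1 : ℤ) K) :
    C.HeadsWithin q₁ K (C.simCfg q₁ st pos L i z) := by
  intro t
  rcases eq_or_ne t i with rfl | ht
  · simpa [simCfg] using h
  · simp [simCfg, ht]

theorem headsWithin_mainCfg {C : CounterProgram k Q} {q₁ : Q} {st : SimState k Q} {pos : ℕ}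
    {L : Fin k → List Bool} {K : ℕ} :
    C.HeadsWithin q₁ K (C.mainCfg q₁ st pos L) := by
  intro t
  simp [mainCfg]

/-- A step that acts on the tape `i` only. -/
theorem step_simCfg {C : CounterProgram k Q} {q₁ : Q} {w : List Bool} {st st' : SimState k Q}
    {pos : ℕ} {L : Fin k → List Bool} {i : Fin k} {l l' : List Bool} {z : ℤ} {a : Option Bool}
    {d : HeadMove} (hst : ∀ b, st ≠ .halted b)
    (ht : ∀ x σ, σ i = tape l z → C.simTrans st x σ = (st', .stay, actOn σ i a d))
    (hl : Function.update (tape l) z a = tape l') :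
    (C.toTM q₁).step w (C.simCfg q₁ st pos (Function.update L i l) i z) =
      some (C.simCfg q₁ st' pos (Function.update L i l') i (moveWork z d)) := by
  have h1 : ¬ (st = .halted true ∨ st = .halted false) := by simp [hst]
  have h2 := ht (readInput w pos)
    (fun t => tape (Function.update L i l t) (Function.update (fun _ => (0 : ℤ)) i z t)) (by simp)
  refine (step_eq_some h1 h2).trans (congrArg some ?_)
  unfold simCfg
  congr 1
  · funext t
    rcases eq_or_ne t i with rfl | ht
    · simp [actOn]
    · simp [actOn, ht, moveWork]
  · funext t
    rcases eq_or_ne t i with rfl | ht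
    · simp [actOn, hl]
    · simp [actOn, ht]

/-! ### Increment and decrement of a binary counter on one tape. -/

section Subroutines

variable {C : CounterProgram k Q} {q₁ : Q} {w : List Bool} {K : ℕ} {b : Bool} {pos : ℕ}
  {L : Fin k → List Bool} {i : Fin k}

/-- The blank in cell `-1` tells the head that it has passed cell `0`; this is why the space bound
includes that cell. -/
theorem haltsWithin_back {q : Q} {l : List Bool} (hl : l.length ≤ K)
    (h : (C.toTM q₁).HaltsWithin w (C.HeadsWithin q₁ K) b
      (C.mainCfg q₁ (.main q) pos (Function.update L i l))) (j : ℕ) (hj : j ≤ l.length) :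
    (C.toTM q₁).HaltsWithin w (C.HeadsWithin q₁ K) b
      (C.simCfg q₁ (.back i q) pos (Function.update L i l) i (j - 1)) := by
  induction j with
  | zero =>
    refine .step (headsWithin_simCfg (by constructor <;> omega)) (step_simCfg (by simp)
      (st' := .main q) (a := none) (d := .right) (l' := l) ?_ ?_) ?_
    · intro x σ hσ
      rw [tape_eq_none_of_neg (by simp)] at hσ
      simp [simTrans, hσ]
    · rw [← tape_eq_none_of_neg (l := l) (z := (0 : ℕ) - 1) (by simp), Function.update_eq_self]
    · simpa [moveWork, simCfg_zero] using h
  | succ j ih =>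
    obtain ⟨c, hc⟩ : ∃ c, tape l ((j + 1 : ℕ) - 1) = some c :=
      ⟨l[j], by simp [tape]⟩
    refine .step (headsWithin_simCfg (by constructor <;> omega)) (step_simCfg (by simp)
      (st' := .back i q) (a := some c) (d := .left) (l' := l) ?_ ?_) ?_
    · intro x σ hσ
      rw [hc] at hσ
      simp [simTrans, hσ]
    · rw [← hc, Function.update_eq_self]
    · simpa [moveWork] using ih (by omega)

/-- After an underflow the flipped digits are meaningless and are erased; the empty tape has value
`0`. The induction takes off the last digit, the one under the head. -/
theorem haltsWithin_erase {q : Q} (l : List Bool) (hl : l.length ≤ K)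
    (h : (C.toTM q₁).HaltsWithin w (C.HeadsWithin q₁ K) b
      (C.mainCfg q₁ (.main q) pos (Function.update L i []))) :
    (C.toTM q₁).HaltsWithin w (C.HeadsWithin q₁ K) b
      (C.simCfg q₁ (.erase i q) pos (Function.update L i l) i (l.length - 1)) := by
  induction l using List.reverseRecOn with
  | nil =>
    refine .step (headsWithin_simCfg (by constructor <;> omega)) (step_simCfg (by simp)
      (st' := .main q) (a := none) (d := .right) (l' := []) ?_ ?_) ?_
    · intro x σ hσ
      rw [tape_eq_none_of_neg (by simp)] at hσ
      simp [simTrans, hσ]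
    · funext z; simp [tape_nil, Function.update_apply]
    · simpa [moveWork, simCfg_zero] using h
  | append_singleton l c ih =>
    simp only [List.length_append, List.length_singleton] at hl ⊢
    rw [Nat.cast_add, Nat.cast_one, add_sub_cancel_right]
    refine .step (headsWithin_simCfg (by constructor <;> omega)) (step_simCfg (by simp)
      (st' := .erase i q) (a := none) (d := .left) (l' := l) ?_ ?_) ?_
    · intro x σ hσ
      rw [tape_append_length] at hσ
      simp [simTrans, hσ]
    · exact update_tape_concat_none l c
    · simpa [moveWork] using ih (by omega)

/-- Here `pre` holds the digits already passed and `l` those from the head on. The hypotheses `h`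
and `h₀` are the continuations for the two outcomes of `carry`. -/
theorem haltsWithin_sweep {e : Bool} {q q₀ : Q} (l pre : List Bool)
    (hl : (pre ++ l).length ≤ K)
    (h : ∀ l', carry e l = some l' → (pre ++ l').length ≤ K ∧
      (C.toTM q₁).HaltsWithin w (C.HeadsWithin q₁ K) b
        (C.mainCfg q₁ (.main q) pos (Function.update L i (pre ++ l'))))
    (h₀ : carry e l = none → (C.toTM q₁).HaltsWithin w (C.HeadsWithin q₁ K) b
        (C.mainCfg q₁ (.main q₀) pos (Function.update L i []))) :
    (C.toTM q₁).HaltsWithin w (C.HeadsWithin q₁ K) b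
      (C.simCfg q₁ (.sweep e i q q₀) pos (Function.update L i (pre ++ l)) i pre.length) := by
  induction l generalizing pre with
  | nil =>
    have hp : (pre.length : ℤ) ∈ Set.Icc (-1 : ℤ) K := by simp at hl ⊢; omega
    cases e
    · refine .step (headsWithin_simCfg hp) (step_simCfg (by simp)
        (st' := .erase i q₀) (a := none) (d := .left) (l' := pre) ?_ ?_) ?_
      · intro x σ hσ
        rw [tape_append_length] at hσ
        simp at hσ
        simp [simTrans, hσ]
      · have : tape pre pre.length = none := by simp [tape]
        rw [List.append_nil, ← this, Function.update_eq_self]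
      · exact haltsWithin_erase pre (by simpa using hl) (h₀ rfl)
    · obtain ⟨h1, h2⟩ := h [true] rfl
      refine .step (headsWithin_simCfg hp) (step_simCfg (by simp)
        (st' := .back i q) (a := some true) (d := .left) (l' := pre ++ [true]) ?_ ?_) ?_
      · intro x σ hσ
        rw [tape_append_length] at hσ
        simp at hσ
        simp [simTrans, hσ]
      · exact update_tape_append pre [] true
      · exact haltsWithin_back h1 h2 pre.length (by simp)
  | cons c l ih =>
    have hp : (pre.length : ℤ) ∈ Set.Icc (-1 : ℤ) K := by simp at hl ⊢; omega
    by_cases hc : c = e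
    · refine .step (headsWithin_simCfg hp) (step_simCfg (by simp)
        (st' := .sweep e i q q₀) (a := some !e) (d := .right) (l' := (pre ++ [!e]) ++ l) ?_ ?_) ?_
      · intro x σ hσ
        rw [tape_append_length] at hσ
        simp at hσ
        simp [simTrans, hσ, hc]
      · simpa using update_tape_append pre (c :: l) (!e)
      · have := ih (pre ++ [!e]) (by simpa using hl) ?_ ?_
        · simpa [moveWork] using this
        · intro l' hl'
          simpa using h ((!e) :: l') (by simp [carry, hc, hl'])
        · intro hl'
          exact h₀ (by simp [carry, hc, hl'])
    · obtain ⟨h1, h2⟩ := h (e :: l) (by simp [carry, hc])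
      refine .step (headsWithin_simCfg hp) (step_simCfg (by simp)
        (st' := .back i q) (a := some e) (d := .left) (l' := pre ++ e :: l) ?_ ?_) ?_
      · intro x σ hσ
        rw [tape_append_length] at hσ
        simp at hσ
        simp [simTrans, hσ, hc]
      · exact update_tape_append pre (c :: l) e
      · exact haltsWithin_back h1 h2 pre.length (by simp)

end Subroutines

/-- A step that leaves the work tapes alone. -/
theorem step_mainCfg {C : CounterProgram k Q} {q₁ q : Q} {w : List Bool} {st' : SimState k Q}
    {pos : ℕ} {L : Fin k → List Bool} {d : HeadMove}
    (ht : ∀ σ, C.simTrans (.main q) (readInput w pos) σ = (st', d, fun t => (σ t, .stay))) :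
    (C.toTM q₁).step w (C.mainCfg q₁ (.main q) pos L) =
      some (C.mainCfg q₁ st' (moveInput w.length pos d) L) := by
  simp [OfflineTM.step, mainCfg, toTM, ht, moveWork]

/-- A counter program whose counters stay below `2 ^ K` is simulated within the cells from `-1`
to `K` of the work tapes. -/
theorem Halts.haltsWithin {C : CounterProgram k Q} {q₁ : Q} {w : List Bool} {b : Bool} {K : ℕ}
    {I : CounterCfg k Q → Prop} (hI : ∀ c c', I c → C.step w c = .inl c' → I c')
    (hK : ∀ c, I c → ∀ i, c.cnt i < 2 ^ K) {c : CounterCfg k Q} (h : C.Halts w b c) (hc : I c)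
    (L : Fin k → List Bool) (hL : ∀ i, (L i).length ≤ K) (hv : ∀ i, value (L i) = c.cnt i) :
    (C.toTM q₁).HaltsWithin w (C.HeadsWithin q₁ K) b (C.mainCfg q₁ (.main c.state) c.pos L) := by
  -- The counters determine the digits only up to leading zeros, so `L` has to vary.
  induction h generalizing L with
  | @halt c h =>
    have hb : C c.state (readInput w c.pos) = .halt b := by
      unfold CounterProgram.step at h
      split at h <;> simp_all
    refine .step headsWithin_mainCfg (step_mainCfg (st' := .halted b) (d := .stay) ?_) ?_
    · intro σ; simp [simTrans, hb]
    · refine .halt headsWithin_mainCfg ?_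
      cases b <;> simp [mainCfg, toTM]
  | @step c c' hs _ ih =>
    have hc' := hI c c' hc hs
    -- Both counter instructions start a sweep and differ only in the continuations.
    have hsweep : ∀ (e : Bool) (i : Fin k) (d : HeadMove) (q q₀ : Q),
        (∀ σ, C.simTrans (.main c.state) (readInput w c.pos) σ =
          (.sweep e i q q₀, d, fun t => (σ t, .stay))) →
        (∀ l', carry e (L i) = some l' → l'.length ≤ K ∧
          (C.toTM q₁).HaltsWithin w (C.HeadsWithin q₁ K) b
            (C.mainCfg q₁ (.main q) (moveInput w.length c.pos d) (Function.update L i l'))) →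
        (carry e (L i) = none → (C.toTM q₁).HaltsWithin w (C.HeadsWithin q₁ K) b
            (C.mainCfg q₁ (.main q₀) (moveInput w.length c.pos d) (Function.update L i []))) →
        (C.toTM q₁).HaltsWithin w (C.HeadsWithin q₁ K) b
          (C.mainCfg q₁ (.main c.state) c.pos L) := by
      intro e i d q q₀ ht h h₀
      refine .step headsWithin_mainCfg (step_mainCfg ht) ?_
      have := haltsWithin_sweep (C := C) (q₁ := q₁) (w := w) (K := K) (b := b)
        (pos := moveInput w.length c.pos d) (L := L) (i := i) (e := e) (q := q) (q₀ := q₀)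
        (L i) [] (hL i) h h₀
      simpa [simCfg_zero] using this
    unfold CounterProgram.step at hs
    split at hs
    · rename_i i d q hC
      obtain rfl := Sum.inl.inj hs
      refine hsweep true i d q q (fun σ => by simp [simTrans, hC]) ?_
        fun h => absurd h (carry_true_ne_none _)
      intro l' hl'
      have hval : value l' = c.cnt i + 1 := by rw [value_carry_true hl', hv]
      have hlen : l'.length ≤ K := by
        refine length_carry_true_le hl' (hL i) ?_
        -- The bound is applied to the counters after the increment.
        have := hK _ hc' i
        simpa [hval] using this
      refine ⟨hlen, ih hc' _ ?_ ?_⟩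
      · intro t; rcases eq_or_ne t i with rfl | ht <;> simp [*]
      · intro t; rcases eq_or_ne t i with rfl | ht <;> simp [*]
    · rename_i i d q q₀ hC
      obtain rfl := Sum.inl.inj hs
      refine hsweep false i d q q₀ (fun σ => by simp [simTrans, hC]) ?_ ?_
      · intro l' hl'
        have hval := value_carry_false hl'
        rw [hv] at hval
        have hlen : l'.length ≤ K := by rw [length_carry_false hl']; exact hL i
        refine ⟨hlen, ?_⟩
        have := ih hc' (Function.update L i l') ?_ ?_
        · simpa [hval] using this
        · intro t; rcases eq_or_ne t i with rfl | ht <;> simp [*]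
        · intro t; rcases eq_or_ne t i with rfl | ht <;> simp [*]
      -- On underflow the truncated `c.cnt i - 1` is `0`, the value of the erased tape.
      · intro hnone
        have hval := value_eq_zero_of_carry_false hnone
        rw [hv] at hval
        have := ih hc' (Function.update L i []) ?_ ?_
        · simpa [hval] using this
        · intro t; rcases eq_or_ne t i with rfl | ht <;> simp [*]
        · intro t; rcases eq_or_ne t i with rfl | ht <;> simp [*, value]
    · rename_i d q hC
      obtain rfl := Sum.inl.inj hs
      refine .step headsWithin_mainCfg (step_mainCfg (st' := .main q) (d := d) ?_) (ih hc' L hL hv)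
      intro σ; simp [simTrans, hC]
    · cases hs

/-- The space bound and the output of the machine that simulates a counter program. -/
theorem outputs_and_visited {C : CounterProgram k Q} {q₁ : Q} {w : List Bool} {b : Bool} {K : ℕ}
    {I : CounterCfg k Q → Prop} (hI : ∀ c c', I c → C.step w c = .inl c' → I c')
    (hK : ∀ c, I c → ∀ i, c.cnt i < 2 ^ K) (h₀ : I ⟨q₁, 1, fun _ => 0⟩)
    (h : C.Halts w b ⟨q₁, 1, fun _ => 0⟩) :
    (C.toTM q₁).Outputs w b ∧ ((C.toTM q₁).visited w).encard ≤ (k * (K + 2) : ℕ) := by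
  have init_eq : (C.toTM q₁).init = C.mainCfg q₁ (.main q₁) 1 (fun _ => []) := by
    simp only [OfflineTM.init, mainCfg, tape_nil]
  have hw : (C.toTM q₁).HaltsWithin w (C.HeadsWithin q₁ K) b (C.toTM q₁).init := by
    rw [init_eq]
    exact h.haltsWithin hI hK h₀ _ (fun _ => by simp) (fun _ => rfl)
  refine ⟨hw.exists_reaches, ?_⟩
  have hsub : (C.toTM q₁).visited w ⊆
      (((Finset.univ : Finset (Fin k)) ×ˢ Finset.Icc (-1 : ℤ) K : Finset (Fin k × ℤ)) :
        Set (Fin k × ℤ)) := by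
    rintro ⟨t, z⟩ ⟨c, hc, hz⟩
    have := hw.of_reaches hc t
    rw [show c.workPos t = z from hz] at this
    simpa using this
  refine (Set.encard_le_encard hsub).trans ?_
  rw [Set.encard_coe_eq_coe_finsetCard, Finset.card_product, Finset.card_univ, Fintype.card_fin,
    Int.card_Icc]
  have : ((K : ℤ) + 1 - -1).toNat = K + 2 := by omega
  rw [this]

end CounterProgram

/-! ### The program that follows the water -/

namespace HoseProgram

open OfflineTM

/-- The states of the program that follows the water. The parameter `t` tells whether it is Bob's
turn. -/
inductive State : Type
  /-- Count the input bits. -/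
  | load
  /-- Return to the first input bit. -/
  | rewind
  /-- At the delimiter of a block. -/
  | start (t : Bool)
  /-- On the first bit after the delimiter. -/
  | first (t : Bool)
  /-- Read the distance. -/
  | read (t : Bool)
  /-- At a delimiter, about to pass to the next one. -/
  | jump (t : Bool)
  /-- Leave the delimiter. -/
  | leave (t : Bool)
  /-- Look for the next delimiter. -/
  | seek (t : Bool)
  /-- Out of fuel. -/
  | fail

instance : Finite State := by
  let g : State → Fin 9 × Bool := fun
    | .load => (0, false)
    | .rewind => (1, false)
    | .start t => (2, t)
    | .first t => (3, t)
    | .read t => (4, t)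
    | .jump t => (5, t)
    | .leave t => (6, t)
    | .seek t => (7, t)
    | .fail => (8, false)
  refine Finite.of_injective g ?_
  rintro (_ | _ | _ | _ | _ | _ | _ | _ | _) (_ | _ | _ | _ | _ | _ | _ | _ | _) h <;>
    simp_all [g]

/-- Alice's distances lead to the right, Bob's to the left. -/
def dir (t : Bool) : HeadMove := if t then .left else .right

/-- The input is a sequence of blocks `0 1^d`, where `d` tells by how many blocks to move on; the
program halts at a block with `d = 0`. Counter `0` is fuel, counter `1` holds the distance. -/
def prog : CounterProgram 2 State
  | .load, .bit _ => .inc 0 .right .load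
  | .load, _ => .move .left .rewind
  | .rewind, .leftEnd => .move .right (.start false)
  | .rewind, _ => .move .left .rewind
  | .start t, _ => .move .right (.first t)
  | .first t, .bit true => .inc 1 .right (.read t)
  | .first t, _ => .halt t
  | .read t, .bit true => .inc 1 .right (.read t)
  | .read t, _ => .dec 0 .stay (.jump t) .fail
  | .jump t, _ => .dec 1 .stay (.leave t) (.start !t)
  | .leave t, _ => .move (dir t) (.seek t)
  | .seek t, .bit true => .move (dir t) (.seek t)
  | .seek t, .bit false => .move .stay (.jump t)
  | .seek _, _ => .halt false
  | .fail, _ => .halt false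

/-- The configuration with fuel `F` and distance `a`. -/
def cfg (q : State) (pos F a : ℕ) : CounterCfg 2 State := ⟨q, pos, ![F, a]⟩

theorem update_zero (F a v : ℕ) : Function.update ![F, a] 0 v = ![v, a] := by
  ext i; fin_cases i <;> simp

theorem update_one (F a v : ℕ) : Function.update ![F, a] 1 v = ![F, v] := by
  ext i; fin_cases i <;> simp

theorem readInput_zero (w : List Bool) : readInput w 0 = .leftEnd := rfl

theorem readInput_append (u v : List Bool) (c : Bool) :
    readInput (u ++ c :: v) (u.length + 1) = .bit c := by
  simp [readInput]

theorem readInput_of_lt {w : List Bool} {p : ℕ} (h : p < w.length) :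
    ∃ c, readInput w (p + 1) = .bit c :=
  ⟨w[p], by simp [readInput, h]⟩

theorem readInput_of_ge {w : List Bool} {p : ℕ} (h : w.length ≤ p) :
    readInput w (p + 1) = .rightEnd := by
  simp [readInput, h]

/-! ### Single steps of the program, read backwards. -/

section Steps

variable {w : List Bool} {b : Bool} {pos F a : ℕ} {t : Bool}

theorem halts_load_bit {c : Bool} (hr : readInput w pos = .bit c)
    (h : prog.Halts w b (cfg .load (min (pos + 1) (w.length + 1)) (F + 1) a)) :
    prog.Halts w b (cfg .load pos F a) :=
  .step (c' := cfg .load (min (pos + 1) (w.length + 1)) (F + 1) a)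
    (by simp [CounterProgram.step, prog, cfg, hr, update_zero, moveInput]) h

theorem halts_load_end (hr : ∀ c, readInput w pos ≠ .bit c)
    (h : prog.Halts w b (cfg .rewind (pos - 1) F a)) :
    prog.Halts w b (cfg .load pos F a) := by
  refine .step (c' := cfg .rewind (pos - 1) F a) ?_ h
  cases hp : readInput w pos <;> simp_all [CounterProgram.step, prog, cfg, moveInput]

theorem halts_rewind (h : prog.Halts w b (cfg (.start false) 1 F a)) (pos : ℕ) :
    prog.Halts w b (cfg .rewind pos F a) := by
  induction pos with
  | zero =>
    refine .step (c' := cfg (.start false) 1 F a) ?_ h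
    simp [CounterProgram.step, prog, cfg, readInput_zero, moveInput]
  | succ p ih =>
    refine .step (c' := cfg .rewind p F a) ?_ ih
    by_cases hp : p < w.length
    · obtain ⟨c, hc⟩ := readInput_of_lt hp
      simp [CounterProgram.step, prog, cfg, hc, moveInput]
    · simp [CounterProgram.step, prog, cfg, readInput_of_ge (not_lt.1 hp), moveInput]

theorem halts_start (h : prog.Halts w b (cfg (.first t) (min (pos + 1) (w.length + 1)) F a)) :
    prog.Halts w b (cfg (.start t) pos F a) :=
  .step (c' := cfg (.first t) (min (pos + 1) (w.length + 1)) F a)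
    (by simp [CounterProgram.step, prog, cfg, moveInput]) h

theorem halts_first_true (hr : readInput w pos = .bit true)
    (h : prog.Halts w b (cfg (.read t) (min (pos + 1) (w.length + 1)) F (a + 1))) :
    prog.Halts w b (cfg (.first t) pos F a) :=
  .step (c' := cfg (.read t) (min (pos + 1) (w.length + 1)) F (a + 1))
    (by simp [CounterProgram.step, prog, cfg, hr, update_one, moveInput]) h

theorem halts_first_end (hr : readInput w pos ≠ .bit true) :
    prog.Halts w t (cfg (.first t) pos F a) := by
  refine .halt ?_
  rcases hp : readInput w pos with _ | _ | (_ | _) <;>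
    simp_all [CounterProgram.step, prog, cfg]

theorem halts_read_true (hr : readInput w pos = .bit true)
    (h : prog.Halts w b (cfg (.read t) (min (pos + 1) (w.length + 1)) F (a + 1))) :
    prog.Halts w b (cfg (.read t) pos F a) :=
  .step (c' := cfg (.read t) (min (pos + 1) (w.length + 1)) F (a + 1))
    (by simp [CounterProgram.step, prog, cfg, hr, update_one, moveInput]) h

theorem halts_read_end (hr : readInput w pos ≠ .bit true)
    (h : prog.Halts w b (cfg (.jump t) pos F a)) :
    prog.Halts w b (cfg (.read t) pos (F + 1) a) := by
  refine .step (c' := cfg (.jump t) pos F a) ?_ h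
  rcases hp : readInput w pos with _ | _ | (_ | _) <;>
    simp_all [CounterProgram.step, prog, cfg, update_zero, moveInput]

theorem halts_read_end_zero (hr : readInput w pos ≠ .bit true) :
    prog.Halts w false (cfg (.read t) pos 0 a) := by
  refine .step (c' := cfg .fail pos 0 a) ?_ (.halt (by simp [CounterProgram.step, prog, cfg]))
  rcases hp : readInput w pos with _ | _ | (_ | _) <;>
    simp_all [CounterProgram.step, prog, cfg, update_zero, moveInput]

theorem halts_jump_zero (h : prog.Halts w b (cfg (.start !t) pos F 0)) :
    prog.Halts w b (cfg (.jump t) pos F 0) :=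
  .step (c' := cfg (.start !t) pos F 0)
    (by simp [CounterProgram.step, prog, cfg, update_one, moveInput]) h

theorem halts_jump_succ
    (h : prog.Halts w b (cfg (.seek t) (moveInput w.length pos (dir t)) F a)) :
    prog.Halts w b (cfg (.jump t) pos F (a + 1)) :=
  .step (c' := cfg (.leave t) pos F a)
    (by simp [CounterProgram.step, prog, cfg, update_one, moveInput])
    (.step (c' := cfg (.seek t) (moveInput w.length pos (dir t)) F a)
      (by simp [CounterProgram.step, prog, cfg]) h)

theorem halts_seek_true (hr : readInput w pos = .bit true)
    (h : prog.Halts w b (cfg (.seek t) (moveInput w.length pos (dir t)) F a)) :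
    prog.Halts w b (cfg (.seek t) pos F a) :=
  .step (c' := cfg (.seek t) (moveInput w.length pos (dir t)) F a)
    (by simp [CounterProgram.step, prog, cfg, hr]) h

theorem halts_seek_false (hr : readInput w pos = .bit false)
    (h : prog.Halts w b (cfg (.jump t) pos F a)) :
    prog.Halts w b (cfg (.seek t) pos F a) :=
  .step (c' := cfg (.jump t) pos F a)
    (by simp [CounterProgram.step, prog, cfg, hr, moveInput]) h

theorem halts_seek_end (hr : ∀ c, readInput w pos ≠ .bit c) :
    prog.Halts w false (cfg (.seek t) pos F a) := by
  refine .halt ?_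
  rcases hp : readInput w pos with _ | _ | (_ | _) <;>
    simp_all [CounterProgram.step, prog, cfg]

end Steps

/-- The loading phase provides as much fuel as there are input bits. -/
theorem halts_init {w : List Bool} {b : Bool}
    (h : prog.Halts w b (cfg (.start false) 1 w.length 0)) :
    prog.Halts w b (cfg .load 1 0 0) := by
  suffices ∀ j F, F + j = w.length → prog.Halts w b (cfg .load (F + 1) F 0) from
    this w.length 0 (by simp)
  intro j
  induction j with
  | zero =>
    intro F hF
    obtain rfl : F = w.length := by omega
    refine halts_load_end (fun c => ?_) (halts_rewind h _)
    simp [readInput_of_ge le_rfl]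
  | succ j ih =>
    intro F hF
    obtain ⟨c, hc⟩ := readInput_of_lt (w := w) (p := F) (by omega)
    refine halts_load_bit hc ?_
    rw [min_eq_left (by omega)]
    exact ih (F + 1) (by omega)

/-! ### Termination on all inputs -/

/-- The head meets a delimiter or an end marker; `j` is the distance to the end marker ahead. -/
theorem exists_halts_seek {w : List Bool} {t : Bool} {F a : ℕ}
    (h : ∀ pos, pos ≤ w.length + 1 → ∃ b, prog.Halts w b (cfg (.jump t) pos F a)) (pos : ℕ)
    (hpos : pos ≤ w.length + 1) :
    ∃ b, prog.Halts w b (cfg (.seek t) pos F a) := by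
  suffices ∀ j pos, pos ≤ w.length + 1 → (if t then pos else w.length + 1 - pos) = j →
      ∃ b, prog.Halts w b (cfg (.seek t) pos F a) from this _ pos hpos rfl
  intro j
  induction j with
  | zero =>
    intro pos hpos hj
    refine ⟨_, halts_seek_end fun c => ?_⟩
    cases t
    · obtain rfl : pos = w.length + 1 := by simp at hj; omega
      simp [readInput_of_ge le_rfl]
    · obtain rfl : pos = 0 := by simpa using hj
      simp [readInput_zero]
  | succ j ih =>
    intro pos hpos hj
    rcases hp : readInput w pos with _ | _ | (_ | _)
    · exact ⟨_, halts_seek_end (by simp [hp])⟩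
    · exact ⟨_, halts_seek_end (by simp [hp])⟩
    · obtain ⟨b, hb⟩ := h pos hpos
      exact ⟨b, halts_seek_false hp hb⟩
    · obtain ⟨b, hb⟩ := ih (moveInput w.length pos (dir t))
        (by cases t <;> simp [dir, moveInput]; omega)
        (by cases t <;> simp [dir, moveInput] at hj ⊢ <;> omega)
      exact ⟨b, halts_seek_true hp hb⟩

theorem exists_halts_jump {w : List Bool} {t : Bool} {F : ℕ}
    (h : ∀ pos, pos ≤ w.length + 1 → ∃ b, prog.Halts w b (cfg (.start !t) pos F 0)) (a pos : ℕ)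
    (hpos : pos ≤ w.length + 1) :
    ∃ b, prog.Halts w b (cfg (.jump t) pos F a) := by
  induction a generalizing pos with
  | zero =>
    obtain ⟨b, hb⟩ := h pos hpos
    exact ⟨b, halts_jump_zero hb⟩
  | succ a ih =>
    obtain ⟨b, hb⟩ := exists_halts_seek ih (moveInput w.length pos (dir t))
      (by cases t <;> simp [dir, moveInput]; omega)
    exact ⟨b, halts_jump_succ hb⟩

/-- A run of `1`s ends at the right end marker at the latest; then one unit of fuel is spent, or the
program fails for lack of it. -/
theorem exists_halts_read {w : List Bool} {t : Bool} {F : ℕ}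
    (h : ∀ a pos, pos ≤ w.length + 1 → F ≠ 0 →
      ∃ b, prog.Halts w b (cfg (.jump t) pos (F - 1) a))
    (a pos : ℕ) (hpos : pos ≤ w.length + 1) :
    ∃ b, prog.Halts w b (cfg (.read t) pos F a) := by
  have hend : ∀ a pos, pos ≤ w.length + 1 → readInput w pos ≠ .bit true →
      ∃ b, prog.Halts w b (cfg (.read t) pos F a) := by
    intro a pos hpos hr
    rcases F with _ | F
    · exact ⟨_, halts_read_end_zero hr⟩
    · obtain ⟨b, hb⟩ := h a pos hpos (by simp)
      exact ⟨b, halts_read_end hr hb⟩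
  obtain ⟨j, hj⟩ : ∃ j, pos + j = w.length + 1 := ⟨_, Nat.add_sub_of_le hpos⟩
  induction j generalizing a pos with
  | zero =>
    obtain rfl : pos = w.length + 1 := hj
    exact hend _ _ le_rfl (by simp [readInput_of_ge le_rfl])
  | succ j ih =>
    by_cases hr : readInput w pos = .bit true
    · obtain ⟨b, hb⟩ := ih (a + 1) (pos + 1) (by omega) (by omega)
      exact ⟨b, halts_read_true hr (by rwa [min_eq_left (by omega)])⟩
    · exact hend _ _ hpos hr

/-- Each move costs one unit of fuel, which bounds the number of moves on every input, code or not.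
-/
theorem exists_halts_start (w : List Bool) (F : ℕ) (t : Bool) (pos : ℕ)
    (hpos : pos ≤ w.length + 1) :
    ∃ b, prog.Halts w b (cfg (.start t) pos F 0) := by
  induction F using Nat.strong_induction_on generalizing t pos with
  | _ F ih =>
    by_cases hr : readInput w (min (pos + 1) (w.length + 1)) = .bit true
    · obtain ⟨b, hb⟩ := exists_halts_read (w := w) (t := t) (F := F)
        (fun a pos hpos hF => exists_halts_jump (fun pos hpos => ih (F - 1) (by omega) _ pos hpos)
          a pos hpos) 1 (min (min (pos + 1) (w.length + 1) + 1) (w.length + 1)) (min_le_right _ _)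
      exact ⟨b, halts_start (halts_first_true hr hb)⟩
    · exact ⟨t, halts_start (halts_first_end hr)⟩

theorem exists_halts (w : List Bool) : ∃ b, prog.Halts w b (cfg .load 1 0 0) := by
  obtain ⟨b, hb⟩ := exists_halts_start w w.length false 1 (by simp)
  exact ⟨b, halts_init hb⟩

/-! ### Bounds for the counters -/

/-- The distance is counted while the head moves to the right, as is the fuel. -/
def Inv (N : ℕ) (c : CounterCfg 2 State) : Prop :=
  c.pos ≤ N + 1 ∧ c.cnt 0 ≤ N + 1 ∧ c.cnt 1 ≤ N + 1 ∧
    match c.state with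
    | .load => c.cnt 0 ≤ c.pos ∧ c.cnt 1 = 0
    | .rewind => c.cnt 1 = 0
    | .start _ => c.cnt 1 = 0
    | .first _ => c.cnt 1 = 0
    | .read _ => c.cnt 1 ≤ c.pos
    | _ => True

theorem inv_step {w : List Bool} {c c' : CounterCfg 2 State} (h : Inv w.length c)
    (hs : prog.step w c = .inl c') : Inv w.length c' := by
  obtain ⟨q, pos, cnt⟩ := c
  obtain ⟨h1, h2, h3, h4⟩ := h
  -- A head on a bit is left of the right end marker, so a move to the right does raise the
  -- position; hence a counter that is counted up never overtakes it.
  have hbit : ∀ c, readInput w pos = .bit c → pos ≤ w.length := by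
    intro c hc
    by_contra! hlt
    obtain ⟨p, rfl⟩ : ∃ p, pos = p + 1 := ⟨pos - 1, by omega⟩
    rw [readInput_of_ge (by omega)] at hc
    cases hc
  have hmove : ∀ d, moveInput w.length pos d ≤ w.length + 1 := by
    rintro (_ | _ | _) <;> simp [moveInput] <;> simp at h1 <;> omega
  simp only at h1 h2 h3 h4
  rcases q with _ | _ | t | t | t | t | t | t | _ <;>
    rcases hr : readInput w pos with _ | _ | (_ | _) <;>
    simp only [CounterProgram.step, prog, hr, reduceCtorEq, Sum.inl.injEq] at hs <;>
    subst hs <;>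
    simp only [Inv, hmove, true_and] <;>
    (try split_ifs) <;>
    (try simp only [ne_eq, one_ne_zero, zero_ne_one, not_false_eq_true, Function.update_self,
      Function.update_of_ne, moveInput, and_true]) <;>
    (try have := hbit _ hr) <;>
    omega

/-- The bound `N + 1` is at most `2 ^ (Nat.log 2 N + 1)`; one more doubling makes the inequality
strict. -/
theorem lt_two_pow_of_inv {N : ℕ} {c : CounterCfg 2 State} (h : Inv N c) (i : Fin 2) :
    c.cnt i < 2 ^ (Nat.log 2 N + 2) := by
  have hN : N < 2 ^ (Nat.log 2 N + 1) := Nat.lt_pow_succ_log_self (by norm_num) N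
  have h2 : 2 ^ (Nat.log 2 N + 2) = 2 * 2 ^ (Nat.log 2 N + 1) := by ring
  obtain ⟨_, h0, h1, _⟩ := h
  fin_cases i <;> simp <;> omega

end HoseProgram

/-! ### Runs of the program on sequences of blocks -/

namespace HoseProgram

open OfflineTM

/-- The input that consists of the blocks `0 1^d` for the given distances. -/
def blocks (D : List ℕ) : List Bool :=
  D.flatMap fun d => false :: List.replicate d true

/-- The position of the delimiter of block `i`. -/
def offset (D : List ℕ) (i : ℕ) : ℕ := (blocks (D.take i)).length + 1

theorem blocks_append (D E : List ℕ) : blocks (D ++ E) = blocks D ++ blocks E := by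
  simp [blocks]

theorem length_blocks (D : List ℕ) : (blocks D).length = D.sum + D.length := by
  induction D with
  | nil => rfl
  | cons d D ih =>
    have : blocks (d :: D) = (false :: List.replicate d true) ++ blocks D := rfl
    simp [this, ih]; omega

variable {D : List ℕ} {i d : ℕ}

theorem blocks_eq (h : D[i]? = some d) :
    blocks D =
      blocks (D.take i) ++ false :: (List.replicate d true ++ blocks (D.drop (i + 1))) := by
  obtain ⟨hi, rfl⟩ := List.getElem?_eq_some_iff.1 h
  conv_lhs => rw [← List.take_append_drop i D, List.drop_eq_getElem_cons hi]
  rw [blocks_append]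
  rfl

theorem offset_succ (h : D[i]? = some d) : offset D (i + 1) = offset D i + d + 1 := by
  obtain ⟨hi, rfl⟩ := List.getElem?_eq_some_iff.1 h
  simp only [offset, List.take_add_one, List.getElem?_eq_getElem hi, blocks_append]
  simp [blocks]
  omega

theorem readInput_offset (h : D[i]? = some d) : readInput (blocks D) (offset D i) = .bit false := by
  rw [blocks_eq h]
  exact readInput_append _ _ _

theorem readInput_offset_add (h : D[i]? = some d) {e : ℕ} (he : e < d) :
    readInput (blocks D) (offset D i + e + 1) = .bit true := by
  obtain ⟨g, rfl⟩ : ∃ g, d = e + (g + 1) := ⟨d - e - 1, by omega⟩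
  have : blocks D = (blocks (D.take i) ++ false :: List.replicate e true) ++
      true :: (List.replicate g true ++ blocks (D.drop (i + 1))) := by
    rw [blocks_eq h, List.replicate_add]
    simp [List.replicate_succ]
  rw [this, ← readInput_append (blocks (D.take i) ++ false :: List.replicate e true)]
  congr 1
  simp [offset]; omega

/-- Past the last block, `offset` is the position of the right end marker, so reading the last
distance stops as well. -/
theorem readInput_offset_ne_true (i : ℕ) :
    readInput (blocks D) (offset D i) ≠ .bit true := by
  rcases h : D[i]? with _ | d
  · have : D.take i = D := List.take_of_length_le (by simpa using h)
    rw [offset, this, readInput_of_ge le_rfl]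
    simp
  · simp [readInput_offset h]

theorem offset_succ_le (h : D[i]? = some d) : offset D i + d + 1 ≤ (blocks D).length + 1 := by
  rw [offset, blocks_eq h]
  simp
  omega

section Runs

variable {b t : Bool} {F a : ℕ}

/-- At an empty block the program halts. -/
theorem halts_start_blocks_zero (h : D[i]? = some 0) :
    prog.Halts (blocks D) t (cfg (.start t) (offset D i) F a) := by
  refine halts_start (halts_first_end ?_)
  have := offset_succ_le h
  rw [min_eq_left (by omega)]
  simpa [offset_succ h] using readInput_offset_ne_true (D := D) (i + 1)

/-- At a nonempty block the program reads the distance. -/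
theorem halts_start_blocks_succ (h : D[i]? = some (d + 1))
    (hh : prog.Halts (blocks D) b (cfg (.jump t) (offset D (i + 1)) F (d + 1))) :
    prog.Halts (blocks D) b (cfg (.start t) (offset D i) (F + 1) 0) := by
  have hle := offset_succ_le h
  have hread : ∀ j e, e + j = d + 1 →
      prog.Halts (blocks D) b (cfg (.read t) (offset D i + e + 1) (F + 1) e) := by
    intro j
    induction j with
    | zero =>
      intro e he
      obtain rfl : e = d + 1 := by omega
      rw [← offset_succ h]
      exact halts_read_end (readInput_offset_ne_true _) hh
    | succ j ih =>
      intro e he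
      refine halts_read_true (readInput_offset_add h (by omega)) ?_
      rw [min_eq_left (by omega)]
      exact ih (e + 1) (by omega)
  refine halts_start ?_
  rw [min_eq_left (by omega)]
  refine halts_first_true (readInput_offset_add h (e := 0) (by omega)) ?_
  rw [min_eq_left (by omega)]
  exact hread d 1 (by omega)

/-- One step to the right in a jump. -/
theorem halts_jump_right (h : D[i]? = some d) (hi : i + 1 < D.length)
    (hh : prog.Halts (blocks D) b (cfg (.jump false) (offset D (i + 1)) F a)) :
    prog.Halts (blocks D) b (cfg (.jump false) (offset D i) F (a + 1)) := by
  have hle := offset_succ_le h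
  have hseek : ∀ j e, e + j = d →
      prog.Halts (blocks D) b (cfg (.seek false) (offset D i + e + 1) F a) := by
    intro j
    induction j with
    | zero =>
      intro e he
      obtain rfl : e = d := by omega
      rw [← offset_succ h]
      exact halts_seek_false (readInput_offset (List.getElem?_eq_getElem hi)) hh
    | succ j ih =>
      intro e he
      refine halts_seek_true (readInput_offset_add h (by omega)) ?_
      simp only [dir, moveInput, Bool.false_eq_true, if_false]
      rw [min_eq_left (by omega)]
      exact ih (e + 1) (by omega)
  refine halts_jump_succ ?_
  simp only [dir, moveInput, Bool.false_eq_true, if_false]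
  rw [min_eq_left (by omega)]
  exact hseek d 0 (by omega)

/-- One step to the left in a jump. -/
theorem halts_jump_left (h : D[i]? = some d)
    (hh : prog.Halts (blocks D) b (cfg (.jump true) (offset D i) F a)) :
    prog.Halts (blocks D) b (cfg (.jump true) (offset D (i + 1)) F (a + 1)) := by
  have hseek : ∀ e, e ≤ d →
      prog.Halts (blocks D) b (cfg (.seek true) (offset D i + e) F a) := by
    intro e
    induction e with
    | zero =>
      intro _
      exact halts_seek_false (readInput_offset h) hh
    | succ e ih =>
      intro he
      refine halts_seek_true (readInput_offset_add h (by omega)) ?_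
      simpa [dir, moveInput] using ih (by omega)
  refine halts_jump_succ ?_
  simpa [dir, moveInput, offset_succ h] using hseek d le_rfl

theorem halts_jump_right_many (a : ℕ) (hi : i + a < D.length)
    (hh : prog.Halts (blocks D) b (cfg (.start true) (offset D (i + a)) F 0)) :
    prog.Halts (blocks D) b (cfg (.jump false) (offset D i) F a) := by
  induction a generalizing i with
  | zero => exact halts_jump_zero hh
  | succ a ih =>
    refine halts_jump_right (List.getElem?_eq_getElem (by omega)) (by omega) (ih (by omega) ?_)
    rwa [add_assoc, add_comm 1 a]

/-- Equality in `hi` is allowed: after the last block has been read, a jump starts from the right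
end marker. -/
theorem halts_jump_left_many (a : ℕ) (hi : i + a ≤ D.length)
    (hh : prog.Halts (blocks D) b (cfg (.start false) (offset D i) F 0)) :
    prog.Halts (blocks D) b (cfg (.jump true) (offset D (i + a)) F a) := by
  induction a with
  | zero => exact halts_jump_zero hh
  | succ a ih =>
    rw [← add_assoc]
    exact halts_jump_left (List.getElem?_eq_getElem (by omega)) (ih (by omega))

/-- Alice's move. -/
theorem halts_alice {j : ℕ} (h : D[i]? = some d) (hd : d ≠ 0) (hj : i + 1 + d = j)
    (hlen : j < D.length)
    (hh : prog.Halts (blocks D) b (cfg (.start true) (offset D j) F 0)) :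
    prog.Halts (blocks D) b (cfg (.start false) (offset D i) (F + 1) 0) := by
  subst hj
  obtain ⟨d, rfl⟩ := Nat.exists_eq_succ_of_ne_zero hd
  -- Reading block `i` has already brought the head to delimiter `i + 1`, whence the `i + 1` in
  -- `hj`.
  exact halts_start_blocks_succ h (halts_jump_right_many _ hlen hh)

/-- Bob's move. -/
theorem halts_bob {j : ℕ} (h : D[i]? = some d) (hd : d ≠ 0) (hj : j + d = i + 1)
    (hh : prog.Halts (blocks D) b (cfg (.start false) (offset D j) F 0)) :
    prog.Halts (blocks D) b (cfg (.start true) (offset D i) (F + 1) 0) := by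
  obtain ⟨hi, -⟩ := List.getElem?_eq_some_iff.1 h
  obtain ⟨d, rfl⟩ := Nat.exists_eq_succ_of_ne_zero hd
  refine halts_start_blocks_succ h ?_
  rw [← hj]
  exact halts_jump_left_many _ (by omega) hh

end Runs

end HoseProgram

/-! ### The path of the water -/

namespace GardenHoseGame

/-- `n` double steps, first along `R` and then along `P`, lead from `u` to `v`. -/
inductive DoubleSteps {V : Type*} (R P : V → V → Prop) : ℕ → V → V → Prop
  | refl (u : V) : DoubleSteps R P 0 u u
  | step {n : ℕ} {u x z v : V} (hR : R u x) (hP : P x z) (h : DoubleSteps R P n z v) :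
      DoubleSteps R P (n + 1) u v

/-- In a graph that is the union of a partial matching `R` and a matching `P` of all vertices but
`r`, a maximal path continues alternately along `R` and `P` and ends at a vertex not matched by
`R`. The set `S` contains the vertices visited before. -/
theorem doubleSteps_of_isPath {V : Type*} {G : SimpleGraph V} {R P : V → V → Prop} {r : V}
    (hG : ∀ u v, G.Adj u v ↔ R u v ∨ P u v)
    (hRs : ∀ u v, R u v → R v u) (hPs : ∀ u v, P u v → P v u)
    (hRu : ∀ u v w, R u v → R u w → v = w) (hPu : ∀ u v w, P u v → P u w → v = w)
    (hr : ∀ u, u ≠ r → ∃ v, P u v) {v : V} (n : ℕ) :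
    ∀ {u : V} (p : G.Walk u v) (S : Set V), p.length ≤ n → p.IsPath → u ∈ S → r ∈ S →
      (∀ x ∈ S, ∀ y, P x y → y ∈ S) →
      (∀ x ∈ S, x ≠ u → ∀ y, R x y → y ∈ S ∧ y ≠ u) →
      (∀ x ∈ p.support, x ≠ u → x ∉ S) →
      (∀ w, G.Adj v w → w ∈ S ∨ w ∈ p.support) →
      (∃ m ≤ p.length, DoubleSteps R P m u v) ∧ ∀ y, ¬ R v y := by
  induction n using Nat.strong_induction_on with
  | _ n ih =>
  intro u p S hn hp huS hrS hSP hSR hdisj hmax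
  cases p with
  | nil =>
    -- By maximality an `R`-neighbour of the endpoint would lie in `S`, but `hSR` says that no other
    -- vertex of `S` is matched to it.
    refine ⟨⟨0, le_rfl, .refl _⟩, fun y hy => ?_⟩
    have hadj : G.Adj v y := (hG _ _).2 (.inl hy)
    have hyS : y ∈ S := by
      rcases hmax y hadj with h | h
      · exact h
      · simp at h; exact h ▸ huS
    exact (hSR y hyS hadj.ne' v (hRs _ _ hy)).2 rfl
  | @cons _ x _ hux p =>
    rw [SimpleGraph.Walk.cons_isPath_iff] at hp
    have hxS : x ∉ S := hdisj x (by simp) hux.ne'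
    -- Since `S` is closed under `P`, an edge out of `S` belongs to `R`.
    have hR : R u x := ((hG _ _).1 hux).resolve_right fun h => hxS (hSP u huS x h)
    cases p with
    | nil =>
      -- A maximal path cannot stop before a pipe: the other end `y` would lie in `S` by maximality,
      -- and then so would `v`.
      exfalso
      obtain ⟨y, hy⟩ := hr v fun h => hxS (h ▸ hrS)
      have hadj : G.Adj v y := (hG _ _).2 (.inr hy)
      have hyS : y ∈ S := by
        rcases hmax y hadj with h | h
        · exact h
        · simp at h
          rcases h with h | h
          · exact h ▸ huS
          · exact absurd h hadj.ne'
      exact hxS (hSP y hyS v (hPs _ _ hy))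
    | @cons _ z _ hxz p =>
      obtain ⟨hp, hu⟩ := hp
      rw [SimpleGraph.Walk.cons_isPath_iff] at hp
      obtain ⟨hp, hx⟩ := hp
      simp only [SimpleGraph.Walk.support_cons, List.mem_cons, not_or] at hu
      have hzp : z ∈ p.support := p.start_mem_support
      have huz : u ≠ z := fun h => hu.2 (h ▸ hzp)
      have hzS : z ∉ S := hdisj z (by simp) huz.symm
      have hP : P x z := ((hG _ _).1 hxz).resolve_left fun h =>
        huz (hRu x u z (hRs _ _ hR) h)
      simp only [SimpleGraph.Walk.length_cons] at hn
      suffices (∃ m ≤ p.length, DoubleSteps R P m z v) ∧ ∀ y, ¬ R v y by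
        obtain ⟨⟨m, hm, hsteps⟩, hend⟩ := this
        exact ⟨⟨m + 1, by simp; omega, .step hR hP hsteps⟩, hend⟩
      -- Adding both ends of the pipe keeps the set closed under `P`, and `z` is now the only vertex
      -- in it whose `R`-neighbour can be new.
      refine ih p.length (by omega) p (S ∪ {x, z}) le_rfl hp (by simp) (by simp [hrS]) ?_ ?_ ?_ ?_
      · rintro y (hy | rfl | rfl) y' hy'
        · exact .inl (hSP y hy y' hy')
        · simp [hPu _ _ _ hy' hP]
        · simp [hPu _ _ _ hy' (hPs _ _ hP)]
      · rintro y (hy | rfl | rfl) hyz y' hy'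
        · by_cases hyu : y = u
          · subst hyu
            obtain rfl := hRu _ _ _ hR hy'
            exact ⟨by simp, hxz.ne⟩
          · have := (hSR y hy hyu y' hy').1
            exact ⟨.inl this, fun h => hzS (h ▸ this)⟩
        · obtain rfl := hRu _ _ _ (hRs _ _ hR) hy'
          exact ⟨.inl huS, huz⟩
        · exact absurd rfl hyz
      · rintro y hy hyz (hyS | rfl | rfl)
        · exact hdisj y (by simp [hy]) (fun h => hu.2 (h ▸ hy)) hyS
        · exact hx hy
        · exact hyz rfl
      · intro y hy
        rcases hmax y hy with h | h
        · exact .inl (.inl h)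
        · simp only [SimpleGraph.Walk.support_cons, List.mem_cons] at h
          rcases h with rfl | rfl | h
          · exact .inl (.inl huS)
          · simp
          · exact .inr h

end GardenHoseGame

/-- Needed because `output` is chosen from an existence statement; determinism identifies it with
the result of following the water. -/
theorem CounterProgram.Halts.unique {k : ℕ} {Q : Type} {C : CounterProgram k Q} {w : List Bool}
    {b b' : Bool} {c : CounterCfg k Q} (h : C.Halts w b c) (h' : C.Halts w b' c) : b = b' := by
  induction h with
  | halt hs =>
    cases h' with
    | halt hs' => exact Sum.inr.inj (hs.symm.trans hs')
    | step hs' _ => cases hs.symm.trans hs'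
  | step hs _ ih =>
    cases h' with
    | halt hs' => cases hs.symm.trans hs'
    | step hs' h' =>
      obtain rfl := Sum.inl.inj (hs.symm.trans hs')
      exact ih h'

/-! ### The water's path and the encoding of a game. -/

namespace GardenHoseGame

variable {n s : ℕ}

/-- The connections made by Alice and Bob. -/
def Link (G : GardenHoseGame n s) (x y : Bits n) :
    Option (Fin s) ⊕ Fin s → Option (Fin s) ⊕ Fin s → Prop
  | .inl a, .inl a' => (G.alice x).Adj a a'
  | .inr j, .inr j' => (G.bob y).Adj j j'
  | _, _ => False

/-- The two vertices are the ends of a pipe. -/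
def Pipe : Option (Fin s) ⊕ Fin s → Option (Fin s) ⊕ Fin s → Prop
  | .inl (some i), .inr j => i = j
  | .inr j, .inl (some i) => i = j
  | _, _ => False

theorem graph_adj_iff (G : GardenHoseGame n s) (x y : Bits n) (u v : Option (Fin s) ⊕ Fin s) :
    (G.graph x y).Adj u v ↔ G.Link x y u v ∨ Pipe u v := by
  rcases u with (_ | i) | i <;> rcases v with (_ | j) | j <;>
    simp [graph, pipes, Link, Pipe, SimpleGraph.map_adj, eq_comm]

/-- The water leaves the pipes after an alternating sequence of connections and pipes, at a vertex
without a connection. -/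
theorem Computes.exists_doubleSteps {G : GardenHoseGame n s} {f : Bits n → Bits n → Bool}
    (h : G.Computes f) (x y : Bits n) :
    ∃ v, (∃ m ≤ 2 * s, DoubleSteps (G.Link x y) Pipe m (tap s) v) ∧
      (∀ w, ¬ G.Link x y v w) ∧ v.isRight = f x y := by
  obtain ⟨v, ⟨p, hp, hmax⟩, h0, h1⟩ := h x y
  obtain ⟨⟨m, hm, hsteps⟩, hend⟩ := doubleSteps_of_isPath (R := G.Link x y) (P := Pipe)
    (r := tap s) (G.graph_adj_iff x y)
    (by
      rintro (u | u) (v | v) huv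
      · exact SimpleGraph.Adj.symm huv
      · exact huv
      · exact huv
      · exact SimpleGraph.Adj.symm huv)
    (by rintro ((_ | i) | i) ((_ | j) | j) huv <;> simp_all [Pipe])
    (by
      rintro (u | u) (v | v) (w | w) huv huw <;> simp only [Link] at huv huw
      · exact congrArg _ (G.alice_unique x u v w huv huw)
      · exact congrArg _ (G.bob_unique y u v w huv huw))
    (by
      rintro ((_ | i) | i) ((_ | j) | j) ((_ | l) | l) huv huw <;> simp_all [Pipe])
    (by
      rintro ((_ | i) | i) hu
      · exact absurd rfl hu
      · exact ⟨.inr i, rfl⟩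
      · exact ⟨.inl (some i), rfl⟩)
    p.length p {tap s} le_rfl hp rfl rfl
    (by rintro _ rfl ((_ | j) | j) hj <;> simp [Pipe] at hj)
    (by rintro _ rfl h; exact absurd rfl h)
    (by intro z _ hz; exact hz)
    (fun w hw => .inr (hmax w hw))
  refine ⟨v, ⟨m, ?_, hsteps⟩, hend, ?_⟩
  -- A path has fewer edges than the graph has vertices, which are `2 * s + 1`.
  · have := hp.length_lt
    simp at this
    omega
  · rcases hf : f x y with _ | _
    · rcases v with v | v
      · rfl
      · simp [hf] at h0
    · exact h1 hf

open HoseProgram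

/-- The number of Alice's block for a vertex. -/
def aliceIndex : Option (Fin s) → ℕ
  | none => 0
  | some i => i + 1

theorem aliceIndex_le (a : Option (Fin s)) : aliceIndex a ≤ s := by
  rcases a with _ | i
  · exact Nat.zero_le s
  · exact i.2

/-- The number of the block for a vertex. Alice has `s + 2` blocks, the last of them for padding. -/
def blockIndex : Option (Fin s) ⊕ Fin s → ℕ
  | .inl a => aliceIndex a
  | .inr j => s + 2 + j

open Classical in
/-- The distance in Alice's block for the vertex `a`: it leads to Bob's end of the pipe to which
`a` is connected. -/
noncomputable def aliceDist (G : GardenHoseGame n s) (x : Bits n) (a : Option (Fin s)) : ℕ :=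
  if h : ∃ j : Fin s, (G.alice x).Adj a (some j) then s + 1 + h.choose - aliceIndex a else 0

open Classical in
/-- The distance in Bob's block for the vertex `j`: it leads to Alice's end of the pipe to which
`j` is connected. -/
noncomputable def bobDist (G : GardenHoseGame n s) (y : Bits n) (j : Fin s) : ℕ :=
  if h : ∃ j' : Fin s, (G.bob y).Adj j j' then s + 2 + j - h.choose else 0

theorem aliceDist_of_adj {G : GardenHoseGame n s} {x : Bits n} {a : Option (Fin s)} {j : Fin s}
    (h : (G.alice x).Adj a (some j)) : G.aliceDist x a = s + 1 + j - aliceIndex a := by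
  have hex : ∃ j : Fin s, (G.alice x).Adj a (some j) := ⟨j, h⟩
  have := G.alice_unique x _ _ _ hex.choose_spec h
  rw [aliceDist, dif_pos hex, Option.some.inj this]

theorem bobDist_of_adj {G : GardenHoseGame n s} {y : Bits n} {j j' : Fin s}
    (h : (G.bob y).Adj j j') : G.bobDist y j = s + 2 + j - j' := by
  have hex : ∃ j' : Fin s, (G.bob y).Adj j j' := ⟨j', h⟩
  rw [bobDist, dif_pos hex, G.bob_unique y _ _ _ hex.choose_spec h]

theorem aliceDist_le (G : GardenHoseGame n s) (x : Bits n) (a : Option (Fin s)) :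
    G.aliceDist x a ≤ 2 * s + 2 := by
  unfold aliceDist
  split_ifs with h
  · have := h.choose.2
    omega
  · omega

theorem bobDist_le (G : GardenHoseGame n s) (y : Bits n) (j : Fin s) :
    G.bobDist y j ≤ 2 * s + 2 := by
  unfold bobDist
  split_ifs with h
  · have := j.2
    omega
  · omega

/-- The distances in Alice's blocks. -/
noncomputable def aliceList (G : GardenHoseGame n s) (x : Bits n) : List ℕ :=
  G.aliceDist x none :: List.ofFn fun i => G.aliceDist x (some i)

/-- The distances in Bob's blocks. -/
noncomputable def bobList (G : GardenHoseGame n s) (y : Bits n) : List ℕ :=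
  List.ofFn fun j => G.bobDist y j

/-- The length of the encoding of the connections of one player, with `s` pipes. -/
def codeLength (s : ℕ) : ℕ := (s + 1) * (2 * s + 3) + 1

/-- The given distances with a last one that brings the encoding to the length `m`. -/
def pad (m : ℕ) (D : List ℕ) : List ℕ := D ++ [m - 1 - (blocks D).length]

theorem length_blocks_pad {m : ℕ} {D : List ℕ} (h : (blocks D).length + 1 ≤ m) :
    (blocks (pad m D)).length = m := by
  rw [pad, blocks_append, List.length_append]
  simp only [length_blocks, List.sum_singleton, List.length_singleton] at h ⊢
  omega

/-- There are at most `s + 1` blocks of at most `2 * s + 3` bits; the extra `1` is for the delimiter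
of the padding block. The length depends on `s` only, so both codes can be padded to it. -/
theorem length_blocks_le {D : List ℕ} (hD : D.length ≤ s + 1) (h : ∀ d ∈ D, d ≤ 2 * s + 2) :
    (blocks D).length + 1 ≤ codeLength s := by
  have h1 := List.sum_le_card_nsmul D _ h
  have h2 : D.length * (2 * s + 3) ≤ (s + 1) * (2 * s + 3) := Nat.mul_le_mul_right _ hD
  rw [length_blocks, codeLength]
  rw [smul_eq_mul] at h1
  linarith

theorem length_blocks_aliceList (G : GardenHoseGame n s) (x : Bits n) :
    (blocks (pad (codeLength s) (G.aliceList x))).length = codeLength s := by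
  refine length_blocks_pad (length_blocks_le (by simp [aliceList]) ?_)
  intro d hd
  simp only [aliceList, List.mem_cons, List.mem_ofFn] at hd
  rcases hd with rfl | ⟨i, rfl⟩ <;> exact G.aliceDist_le x _

theorem length_blocks_bobList (G : GardenHoseGame n s) (y : Bits n) :
    (blocks (pad (codeLength s) (G.bobList y))).length = codeLength s := by
  refine length_blocks_pad (length_blocks_le (by simp [bobList]) ?_)
  intro d hd
  simp only [bobList, List.mem_ofFn] at hd
  obtain ⟨j, rfl⟩ := hd
  exact G.bobDist_le y j

/-- All distances. -/
noncomputable def distances (G : GardenHoseGame n s) (x y : Bits n) : List ℕ :=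
  pad (codeLength s) (G.aliceList x) ++ pad (codeLength s) (G.bobList y)

theorem length_distances (G : GardenHoseGame n s) (x y : Bits n) :
    (G.distances x y).length = 2 * s + 3 := by
  simp [distances, pad, aliceList, bobList]
  omega

theorem distances_alice (G : GardenHoseGame n s) (x y : Bits n) (a : Option (Fin s)) :
    (G.distances x y)[aliceIndex a]? = some (G.aliceDist x a) := by
  have ha := aliceIndex_le a
  have hlen : (G.aliceList x).length = s + 1 := by simp [aliceList]
  rw [distances, pad, List.append_assoc, List.getElem?_append_left (by omega)]
  rcases a with _ | i <;> simp [aliceList, aliceIndex]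

theorem distances_bob (G : GardenHoseGame n s) (x y : Bits n) (j : Fin s) :
    (G.distances x y)[s + 2 + (j : ℕ)]? = some (G.bobDist y j) := by
  have hlen : (pad (codeLength s) (G.aliceList x)).length = s + 2 := by simp [pad, aliceList]
  rw [distances, List.getElem?_append_right (by omega), hlen, Nat.add_sub_cancel_left, pad,
    List.getElem?_append_left (by simp [bobList])]
  simp [bobList]

/-- The program follows the water. -/
theorem halts_of_doubleSteps {G : GardenHoseGame n s} {x y : Bits n} {m : ℕ}
    {u v : Option (Fin s) ⊕ Fin s} (h : DoubleSteps (G.Link x y) Pipe m u v)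
    (hv : ∀ w, ¬ G.Link x y v w) (F : ℕ) (hF : m ≤ F) :
    prog.Halts (blocks (G.distances x y)) v.isRight
      (cfg (.start u.isRight) (offset (G.distances x y) (blockIndex u)) F 0) := by
  induction h generalizing F with
  | refl u =>
    -- No connection at the endpoint means the default distance `0`, at which the program outputs
    -- the side it is on.
    refine halts_start_blocks_zero ?_
    rcases u with a | j
    · rw [blockIndex, distances_alice, aliceDist, dif_neg]
      rintro ⟨j, hj⟩
      exact hv (.inl (some j)) hj
    · rw [blockIndex, distances_bob, bobDist, dif_neg]
      rintro ⟨j', hj⟩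
      exact hv (.inr j') hj
  | @step m u z z' v hR hP _ ih =>
    obtain ⟨F, rfl⟩ : ∃ F', F = F' + 1 := ⟨F - 1, by omega⟩
    have ih := ih hv F (by omega)
    rcases u with a | j
    · rcases z with (_ | i) | i
      -- The tap is on no pipe, so `aliceDist` may ignore connections to it.
      · rcases z' with (_ | k) | k <;> exact hP.elim
      · rcases z' with (_ | k) | k
        · exact hP.elim
        · exact hP.elim
        · obtain rfl : i = k := hP
          have ha := aliceIndex_le a
          have hi := i.2
          -- As `aliceIndex a ≤ s`, the truncated subtraction is exact and the distance is positive,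
          -- hence not mistaken for the halting mark.
          refine halts_alice (G.distances_alice x y a) ?_ ?_ ?_ ih <;>
            simp only [aliceDist_of_adj (show (G.alice x).Adj a (some i) from hR), blockIndex,
              length_distances] <;> omega
      · exact hR.elim
    · rcases z with z | i
      · exact hR.elim
      · rcases z' with (_ | k) | k
        · exact hP.elim
        · obtain rfl : k = i := hP
          have hk := k.2
          refine halts_bob (G.distances_bob x y j) ?_ ?_ ih <;>
            simp only [bobDist_of_adj (show (G.bob y).Adj j k from hR), blockIndex,
              aliceIndex] <;> omega
        · exact hP.elim

theorem Computes.halts {G : GardenHoseGame n s} {f : Bits n → Bits n → Bool} (h : G.Computes f)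
    (x y : Bits n) : prog.Halts (blocks (G.distances x y)) (f x y) (cfg .load 1 0 0) := by
  obtain ⟨v, ⟨m, hm, hsteps⟩, hend, hv⟩ := h.exists_doubleSteps x y
  rw [← hv]
  refine halts_init (halts_of_doubleSteps hsteps hend _ ?_)
  -- The `2 * s + 3` delimiters alone provide fuel for the at most `2 * s` double steps.
  rw [length_blocks, length_distances]
  omega

/-- The bits of a list of length `m`. -/
def toBits (m : ℕ) (l : List Bool) : Bits m := fun i => l.getD i false

theorem ofFn_toBits {m : ℕ} {l : List Bool} (h : l.length = m) : List.ofFn (toBits m l) = l := by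
  subst h
  exact List.ext_getElem (by simp) fun i _ hi => by simp [toBits, List.getElem?_eq_getElem hi]

/-- The encoding of Alice's connections. -/
noncomputable def aliceBits (G : GardenHoseGame n s) (x : Bits n) : Bits (codeLength s) :=
  toBits _ (blocks (pad (codeLength s) (G.aliceList x)))

/-- The encoding of Bob's connections. -/
noncomputable def bobBits (G : GardenHoseGame n s) (y : Bits n) : Bits (codeLength s) :=
  toBits _ (blocks (pad (codeLength s) (G.bobList y)))

theorem ofFn_aliceBits_append_ofFn_bobBits (G : GardenHoseGame n s) (x y : Bits n) :
    List.ofFn (G.aliceBits x) ++ List.ofFn (G.bobBits y) = blocks (G.distances x y) := by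
  rw [aliceBits, bobBits, ofFn_toBits (G.length_blocks_aliceList x),
    ofFn_toBits (G.length_blocks_bobList y), distances, blocks_append]

end GardenHoseGame

/-! ### The log-space family and the conclusion. -/

namespace HoseProgram

/-- The family of functions that the program computes. -/
noncomputable def output (m : ℕ) (x y : Bits m) : Bool :=
  (exists_halts (List.ofFn x ++ List.ofFn y)).choose

theorem halts_output {m : ℕ} (x y : Bits m) :
    prog.Halts (List.ofFn x ++ List.ofFn y) (output m x y) (cfg .load 1 0 0) :=
  (exists_halts (List.ofFn x ++ List.ofFn y)).choose_spec

theorem logSpaceComputable_output : LogSpaceComputable output := by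
  -- Two tapes with `log N + 4` cells each; since `log N ≥ 1`, the total `2 * log N + 8` is at most
  -- `10 * log N`.
  refine ⟨prog.toTM .load, 10, fun m x y => ?_⟩
  have init_eq : cfg .load 1 0 0 = ⟨.load, 1, fun _ => 0⟩ := by
    simp only [cfg]
    congr 1
    ext i; fin_cases i <;> rfl
  have hlen : (List.ofFn x ++ List.ofFn y).length = 2 * m := by simp; omega
  obtain ⟨h1, h2⟩ := CounterProgram.outputs_and_visited (K := Nat.log 2 (2 * m) + 2)
    (fun c c' hc hs => inv_step hc hs)
    (fun c hc i => by simpa only [hlen] using lt_two_pow_of_inv hc i)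
    (by simp [Inv]) (init_eq ▸ halts_output x y)
  refine ⟨h1, fun hm => h2.trans ?_⟩
  have : 1 ≤ Nat.log 2 (2 * m) := Nat.log_pos (by norm_num) hm
  exact_mod_cast (by omega : 2 * (Nat.log 2 (2 * m) + 2 + 2) ≤ 10 * Nat.log 2 (2 * m))

end HoseProgram

theorem exists_computes_of_gardenHoseComplexity_le {n b : ℕ} {f : Bits n → Bits n → Bool}
    (h : gardenHoseComplexity f ≤ (b : ℕ∞)) :
    ∃ s ≤ b, ∃ G : GardenHoseGame n s, G.Computes f := by
  -- The infimum over the empty set is `⊤`, which `h` excludes; over a nonempty set it is attained.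
  have hne : {t : ℕ∞ | ∃ (s : ℕ) (G : GardenHoseGame n s),
      G.Computes f ∧ t = (s : ℕ∞)}.Nonempty := by
    rw [Set.nonempty_iff_ne_empty]
    intro hempty
    rw [gardenHoseComplexity, hempty, sInf_empty, top_le_iff] at h
    exact ENat.natCast_ne_top b h
  obtain ⟨s, G, hG, hs⟩ := csInf_mem hne
  refine ⟨s, ?_, G, hG⟩
  rw [gardenHoseComplexity, hs] at h
  exact_mod_cast h

theorem mainTheorem2 (f : ∀ n : ℕ, Bits n → Bits n → Bool)
    (hf : ∃ p : Polynomial ℕ, ∀ n : ℕ,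
      gardenHoseComplexity (f n) ≤ ((p.eval n : ℕ) : ℕ∞)) :
    LogSpaceUpToLocalPreprocessing f := by
  obtain ⟨p, hp⟩ := hf
  choose s hs G hG using fun n => exists_computes_of_gardenHoseComplexity_le (hp n)
  -- The polynomial is `codeLength`, which is monotone, with `p` in place of `s`.
  refine ⟨fun n => GardenHoseGame.codeLength (s n), HoseProgram.output,
    ⟨(p + 1) * (2 * p + 3) + 1, fun n => ?_⟩, HoseProgram.logSpaceComputable_output,
    fun n => ⟨(G n).aliceBits, (G n).bobBits, fun x y => ?_⟩⟩
  · simp only [GardenHoseGame.codeLength, Polynomial.eval_add, Polynomial.eval_mul,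
      Polynomial.eval_one, Polynomial.eval_ofNat]
    gcongr <;> exact hs n
  · refine ((hG n).halts x y).unique ?_
    rw [← GardenHoseGame.ofFn_aliceBits_append_ofFn_bobBits]
    exact HoseProgram.halts_output _ _
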